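/- Let $\mathbb{K}$ be a field of characteristic $0$ and let $\mathbf{d}=(d_1,\dots,d_s)$ be nonnegative integers. On the polynomial algebra $\mathbb{K}[X_{\mathbf d}]$ in the variables $x_i^{(k)}$ ($1\le k\le s$, $0\le i\le d_k$) let $\mathcal{D}_{\mathbf d}$ and $\mathcal{D}_{\mathbf d}^*$ be the $\mathbb{K}$-derivations with $$\mathcal{D}_{\mathbf d}(x_i^{(k)})=i\,x_{i-1}^{(k)},\qquad \mathcal{D}_{\mathbf d}^*(x_i^{(k)})=(d_k-i)\,x_{i+1}^{(k)}$$ (so that $\mathcal{D}_{\mathbf d}(x_0^{(k)})=0$ and $\mathcal{D}_{\mathbf d}^*(x_{d_k}^{(k)})=0$). Let $\mathcal{S}_{\mathbf d}=\ker\mathcal{D}_{\mathbf d}$ be the algebra of joint semi-invariants and $\mathcal{I}_{\mathbf d}=\ker\mathcal{D}_{\mathbf d}\cap\ker\mathcal{D}_{\mathbf d}^*$ the algebra of joint invariants of binary forms of degrees $d_1,\dots,d_s$, both graded by the total degree of polynomials, and let $$\mathcal{PI}_{\mathbf d}(z)=\sum_{m\ge 0}\dim_{\mathbb K}\big((\mathcal{I}_{\mathbf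 d})_m\big)z^m,\qquad \mathcal{PS}_{\mathbf d}(z)=\sum_{m\ge 0}\dim_{\mathbb K}\big((\mathcal{S}_{\mathbf d})_m\big)z^m$$ be their Poincaré series. **Theorem.** Let $n\ge 1$ and $\mathbf{d}=(2,2,\dots,2)$ with $n$ entries. Then, as formal power series in $z$, $$\mathcal{PI}_{\mathbf d}(z)=\sum_{k=1}^n\frac{(-1)^{n-k}}{(n-k)!\,(k-1)!}\,\frac{d^{k-1}}{dz^{k-1}}\left(\sum_{i=0}^{n-k}\binom{n-k}{i}\frac{(n)_i\,(n)_{n-k-i}\,(1-z)\,z^{2n-k-i-1}}{(1-z)^{n+i}(1-z^2)^{2n-k-i}}\right),$$ $$\mathcal{PS}_{\mathbf d}(z)=\sum_{k=1}^n\frac{(-1)^{n-k}}{(n-k)!\,(k-1)!}\,\frac{d^{k-1}}{dz^{k-1}}\left(\sum_{i=0}^{n-k}\binom{n-k}{i}\frac{(n)_i\,(n)_{n-k-i}\,z^{2n-k-i-1}}{(1-z)^{n+i}(1-z^2)^{2n-k-i}}\right),$$ where $(n)_m=n(n+1)\cdots(n+m-1)$, $(n)_0=1$, denotes the shifted factorial.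 -/

import Mathlib

open scoped Nat PowerSeries

noncomputable section

namespace BinaryForms

/-- The index set of the variables `x_i^(k)`, `1 ≤ k ≤ s`, `0 ≤ i ≤ d_k`, attached to the
degree vector `d = (d_1, …, d_s)`. -/
abbrev Var {s : ℕ} (d : Fin s → ℕ) : Type := Σ k : Fin s, Fin (d k + 1)

/-- The derivation `D_d` of `K[X_d]` with `D_d (x_0^(k)) = 0` and
`D_d (x_i^(k)) = i x_{i-1}^(k)` for `1 ≤ i ≤ d_k`. -/
def derivD (K : Type*) [Field K] {s : ℕ} (d : Fin s → ℕ) :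
    Derivation K (MvPolynomial (Var d) K) (MvPolynomial (Var d) K) :=
  MvPolynomial.mkDerivation K fun v =>
    if h : 0 < (v.2 : ℕ) then
      ((v.2 : ℕ) : K) •
        MvPolynomial.X (⟨v.1, ⟨(v.2 : ℕ) - 1, by have := v.2.isLt; omega⟩⟩ : Var d)
    else 0

/-- The dual derivation `D_d^*` of `K[X_d]` with `D_d^* (x_{d_k}^(k)) = 0` and
`D_d^* (x_i^(k)) = (d_k - i) x_{i+1}^(k)` for `0 ≤ i < d_k`. -/
def derivDstar (K : Type*) [Field K] {s : ℕ} (d : Fin s → ℕ) :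
    Derivation K (MvPolynomial (Var d) K) (MvPolynomial (Var d) K) :=
  MvPolynomial.mkDerivation K fun v =>
    if h : (v.2 : ℕ) < d v.1 then
      ((d v.1 : K) - ((v.2 : ℕ) : K)) •
        MvPolynomial.X (⟨v.1, ⟨(v.2 : ℕ) + 1, by omega⟩⟩ : Var d)
    else 0

/-- The algebra `S_d = ker D_d` of joint semi-invariants of binary forms of degrees
`d_1, …, d_s`. -/
def semiInvariants (K : Type*) [Field K] {s : ℕ} (d : Fin s → ℕ) :
    Subalgebra K (MvPolynomial (Var d) K) where
  carrier := {f | derivD K d f = 0}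
  mul_mem' := by
    intro a b ha hb
    simp only [Set.mem_ofPred_eq] at ha hb ⊢
    simp [Derivation.leibniz, ha, hb]
  add_mem' := by
    intro a b ha hb
    simp only [Set.mem_ofPred_eq] at ha hb ⊢
    simp [ha, hb]
  algebraMap_mem' := by
    intro r
    simp only [Set.mem_ofPred_eq]
    exact Derivation.map_algebraMap _ r

/-- The algebra `I_d = ker D_d ∩ ker D_d^*` of joint invariants (the `sl_2`-invariants) of
binary forms of degrees `d_1, …, d_s`. -/
def invariants (K : Type*) [Field K] {s : ℕ} (d : Fin s → ℕ) :
    Subalgebra K (MvPolynomial (Var d) K) where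
  carrier := {f | derivD K d f = 0 ∧ derivDstar K d f = 0}
  mul_mem' := by
    intro a b ha hb
    simp only [Set.mem_ofPred_eq] at ha hb ⊢
    simp [Derivation.leibniz, ha, hb]
  add_mem' := by
    intro a b ha hb
    simp only [Set.mem_ofPred_eq] at ha hb ⊢
    simp [ha, hb]
  algebraMap_mem' := by
    intro r
    simp only [Set.mem_ofPred_eq]
    exact ⟨Derivation.map_algebraMap _ r, Derivation.map_algebraMap _ r⟩

/-- The component `A_m` of a subalgebra `A` of a polynomial ring: the elements of `A` that are
homogeneous of degree `m`. -/
def gradedPart {K σ : Type*} [Field K] (A : Subalgebra K (MvPolynomial σ K)) (m : ℕ) :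
    Submodule K (MvPolynomial σ K) :=
  Subalgebra.toSubmodule A ⊓ MvPolynomial.homogeneousSubmodule σ K m

/-- For finitely many variables the components are finite-dimensional, so that `Module.finrank`
below is their true dimension. -/
theorem finite_gradedPart {K σ : Type*} [Field K] [Finite σ]
    (A : Subalgebra K (MvPolynomial σ K)) (m : ℕ) : Module.Finite K (gradedPart A m) := by
  have h : gradedPart A m ≤ MvPolynomial.restrictTotalDegree σ K m := by
    intro f hf
    rw [MvPolynomial.mem_restrictTotalDegree]
    exact MvPolynomial.IsHomogeneous.totalDegree_le hf.2
  exact Submodule.finiteDimensional_of_le h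

/-- The Poincaré series `∑_m dim(A_m) z^m` of a subalgebra `A` of a polynomial ring, as a formal
power series with rational coefficients. -/
def poincareSeries {K σ : Type*} [Field K] (A : Subalgebra K (MvPolynomial σ K)) : ℚ⟦X⟧ :=
  PowerSeries.mk fun m => (Module.finrank K (gradedPart A m) : ℚ)

/-- `PI_d(z)`, the Poincaré series of the algebra of joint invariants. -/
def PI (K : Type*) [Field K] {s : ℕ} (d : Fin s → ℕ) : ℚ⟦X⟧ :=
  poincareSeries (invariants K d)

/-- `PS_d(z)`, the Poincaré series of the algebra of joint semi-invariants. -/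
def PS (K : Type*) [Field K] {s : ℕ} (d : Fin s → ℕ) : ℚ⟦X⟧ :=
  poincareSeries (semiInvariants K d)

/-- The shifted factorial `(n)_m = n (n+1) ⋯ (n+m-1)`, `(n)_0 = 1`. -/
def shiftedFactorial (n m : ℕ) : ℕ := ∏ j ∈ Finset.range m, (n + j)

end BinaryForms

end

/-! Write n = N + 1. Give x_i^(k) the weight i - 1. Then D lowers weight by 1, D* raises it by 1,
and their commutator acts on weight w as -2w, so they generate an sl_2-action. As weights are
bounded in each degree m, D is injective on positive weights and surjective onto negative ones
(`eq_zero_of_lowering_eq_zero`, `exists_lowering_eq`). Hence dim S_m is the number of monomials of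
degree m and weight 0, and dim I_m is that number minus the number of weight -1.

Counting monomials of weight -t gives the series (1-z)^{-n} z^t B_t(z^2), where B_t(y) = ∑_j
C(N+j,N) C(N+j+t,N) y^j (`mk_ncard_bidegreeFiber`).

The stated formulas come from two auxiliary variables. On the diagonal a = b = z, ∂_a^N of a^{N+t}
(1-ab)^{-n} equals N! z^t B_t(z^2) (`diag_iterate_derivA_X_pow_mul`). The factor (1-b)^{-n} is
constant in a and supplies the missing (1-z)^{-n}. Now ∂_a = (∂_a + ∂_b) - ∂_b, and ∂_a + ∂_b
restricts to d/dz. The binomial theorem therefore gives the outer sum over k, and the Leibniz rule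
for ∂_b on (1-b)^{-n} (1-ab)^{-n} gives the inner sum over i (`sum_iterate_derivative_eq`). -/

namespace BinaryForms

/-! ### Iterated derivations -/

section Derivations

variable {A : Type*} [CommRing A] [Algebra ℚ A]

theorem iterate_derivation_mul (D : Derivation ℚ A A) (n : ℕ) (f g : A) :
    D^[n] (f * g) =
      ∑ i ∈ Finset.range (n + 1), (n.choose i : A) * (D^[i] f * D^[n - i] g) := by
  rw [← Finset.Nat.sum_antidiagonal_eq_sum_range_succ
    (fun i j => (n.choose i : A) * (D^[i] f * D^[j] g))]
  induction n with
  | zero => simp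
  | succ n ih =>
    rw [Function.iterate_succ_apply', ih, map_sum,
      Finset.sum_antidiagonal_choose_succ_mul (fun i j => D^[i] f * D^[j] g),
      ← Finset.sum_add_distrib]
    refine Finset.sum_congr rfl fun p hp => ?_
    have h : n.choose p.2 = n.choose p.1 := by
      rw [← Finset.HasAntidiagonal.mem_antidiagonal.mp hp, Nat.choose_symm_add]
    simp only [Derivation.leibniz, smul_eq_mul, Function.iterate_succ_apply', h,
      Derivation.map_natCast]
    ring

theorem shiftedFactorial_succ (n m : ℕ) :
    shiftedFactorial n (m + 1) = shiftedFactorial n m * (n + m) :=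
  Finset.prod_range_succ _ _

/-- Iterated derivatives of the powers of a solution of `D u = c u²` with `c` constant. -/
theorem iterate_derivation_pow_of_riccati (D : Derivation ℚ A A) {u c : A}
    (hu : D u = c * u ^ 2) (hc : D c = 0) (n p : ℕ) :
    D^[p] (u ^ n) = (shiftedFactorial n p : A) * (c ^ p * u ^ (n + p)) := by
  induction p with
  | zero => simp [shiftedFactorial]
  | succ p ih =>
    rw [Function.iterate_succ_apply', ih, shiftedFactorial_succ]
    simp only [Derivation.leibniz, Derivation.leibniz_pow, Derivation.map_natCast, hu, hc,
      smul_eq_mul, nsmul_eq_mul]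
    -- The power rule involves the truncated exponent `n + p - 1`, so `n + p = 0` is treated apart.
    rcases Nat.eq_zero_or_pos (n + p) with h | h
    · obtain ⟨rfl, rfl⟩ : n = 0 ∧ p = 0 := by omega
      simp
    · obtain ⟨q, hq⟩ : ∃ q, n + p = q + 1 := ⟨n + p - 1, by omega⟩
      have h1 : n + (p + 1) = q + 2 := by omega
      rw [h1, hq]
      push_cast
      ring

theorem iterate_derivation_pow (D : Derivation ℚ A A) {a : A} (ha : D a = 1) (n p : ℕ) :
    D^[p] (a ^ n) = (n.descFactorial p : A) * a ^ (n - p) := by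
  induction p with
  | zero => simp
  | succ p ih =>
    rw [Function.iterate_succ_apply', ih, Nat.descFactorial_succ]
    simp only [Derivation.leibniz, Derivation.leibniz_pow, Derivation.map_natCast, ha,
      smul_eq_mul, nsmul_eq_mul, Nat.sub_sub]
    push_cast
    ring

theorem iterate_derivation_mul_of_map_eq_zero (D : Derivation ℚ A A) {f : A} (hf : D f = 0)
    (p : ℕ) (g : A) : D^[p] (f * g) = f * D^[p] g := by
  induction p with
  | zero => rfl
  | succ p ih => simp [Function.iterate_succ_apply', ih, hf]

/-- For commuting `D₁`, `D₂`, the iterates of `D₁` in terms of those of `D₁ + D₂` and `D₂`. -/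
theorem iterate_derivation_of_commute (D₁ D₂ : Derivation ℚ A A)
    (h : ∀ f, D₁ (D₂ f) = D₂ (D₁ f)) (N : ℕ) (f : A) :
    D₁^[N] f = ∑ p ∈ Finset.range (N + 1),
      ((N.choose p : ℚ) * (-1) ^ p) • (D₁ + D₂)^[N - p] (D₂^[p] f) := by
  set T : Module.End ℚ A := (D₁ : A →ₗ[ℚ] A) + (D₂ : A →ₗ[ℚ] A) with hT
  set S : Module.End ℚ A := (D₂ : A →ₗ[ℚ] A) with hS
  have hST : S * T = T * S := LinearMap.ext fun x => by
    simp only [hT, hS, Module.End.mul_apply, LinearMap.add_apply, Derivation.coeFn_coe,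
      map_add, h]
  -- The claim is the binomial theorem for D₁ = -D₂ + (D₁ + D₂) in the endomorphism ring.
  have hcomm : Commute (-S) T := Commute.neg_left hST
  have key : ((D₁ : A →ₗ[ℚ] A) : Module.End ℚ A) = -S + T := by
    simp [hT, hS]
  have h1 : ∀ k x, (T ^ k) x = (D₁ + D₂)^[k] x := fun k x => by
    rw [Module.End.pow_apply]; rfl
  have h2 : ∀ k x, (S ^ k) x = D₂^[k] x := fun k x => by
    rw [Module.End.pow_apply]; rfl
  have h3 : D₁^[N] f = (((D₁ : A →ₗ[ℚ] A) : Module.End ℚ A) ^ N) f := by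
    rw [Module.End.pow_apply]; rfl
  rw [h3, key, hcomm.add_pow, LinearMap.sum_apply]
  refine Finset.sum_congr rfl fun p _ => ?_
  have h4 : ((-S) ^ p) f = ((-1 : ℚ) ^ p) • (S ^ p) f := by
    rw [← neg_one_smul ℚ S, smul_pow, LinearMap.smul_apply]
  rw [(hcomm.pow_pow p (N - p)).eq, ← h1, ← h2, ← ((N.choose p).cast_commute _).eq]
  simp only [Module.End.mul_apply, h4, map_smul, mul_smul, Module.End.natCast_apply,
    Nat.cast_smul_eq_nsmul]
  rw [smul_comm]

end Derivations

/-! ### Two-variable calculus and restriction to the diagonal -/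

/-- The polynomial ring in `a`, `b`, `u`, `v`, where `u` and `v` stand for `1 / (1 - b)` and
`1 / (1 - a b)`; this is the derivation `∂ / ∂a`. -/
noncomputable def derivA : Derivation ℚ (MvPolynomial (Fin 4) ℚ) (MvPolynomial (Fin 4) ℚ) :=
  MvPolynomial.mkDerivation ℚ ![1, 0, 0, MvPolynomial.X 1 * MvPolynomial.X 3 ^ 2]

/-- The derivation `∂ / ∂b` on the ring of `derivA`. -/
noncomputable def derivB : Derivation ℚ (MvPolynomial (Fin 4) ℚ) (MvPolynomial (Fin 4) ℚ) :=
  MvPolynomial.mkDerivation ℚ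
    ![0, 1, MvPolynomial.X 2 ^ 2, MvPolynomial.X 0 * MvPolynomial.X 3 ^ 2]

/-- The restriction to the diagonal `a = b = z`. -/
noncomputable def diag : MvPolynomial (Fin 4) ℚ →ₐ[ℚ] ℚ⟦X⟧ :=
  MvPolynomial.aeval
    ![PowerSeries.X, PowerSeries.X, (1 - PowerSeries.X)⁻¹, (1 - PowerSeries.X ^ 2)⁻¹]

theorem derivA_X (i : Fin 4) : derivA (MvPolynomial.X i) =
    (![1, 0, 0, MvPolynomial.X 1 * MvPolynomial.X 3 ^ 2] : Fin 4 → MvPolynomial (Fin 4) ℚ) i :=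
  MvPolynomial.mkDerivation_X _ _ _

theorem derivB_X (i : Fin 4) : derivB (MvPolynomial.X i) =
    (![0, 1, MvPolynomial.X 2 ^ 2, MvPolynomial.X 0 * MvPolynomial.X 3 ^ 2] :
      Fin 4 → MvPolynomial (Fin 4) ℚ) i :=
  MvPolynomial.mkDerivation_X _ _ _

theorem diag_X (i : Fin 4) : diag (MvPolynomial.X i) =
    (![PowerSeries.X, PowerSeries.X, (1 - PowerSeries.X)⁻¹, (1 - PowerSeries.X ^ 2)⁻¹] :
      Fin 4 → ℚ⟦X⟧) i :=
  MvPolynomial.aeval_X _ _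

theorem derivA_derivB (f : MvPolynomial (Fin 4) ℚ) : derivA (derivB f) = derivB (derivA f) := by
  have h : ⁅derivA, derivB⁆ = 0 := by
    refine MvPolynomial.derivation_ext fun i => ?_
    rw [Derivation.commutator_apply]
    fin_cases i <;>
      simp [derivA_X, derivB_X, Derivation.leibniz, Derivation.leibniz_pow]
    ring
  have := congrArg (fun D => D f) h
  rwa [Derivation.commutator_apply, Derivation.zero_apply, sub_eq_zero] at this

/-- Chain rule along a = b = z. The Leibniz rule reduces it to the four generators; for v it reads
d/dz (1-z²)⁻¹ = 2z (1-z²)⁻². -/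
theorem derivative_diag (f : MvPolynomial (Fin 4) ℚ) :
    PowerSeries.derivative ℚ (diag f) = diag ((derivA + derivB) f) := by
  induction f using MvPolynomial.induction_on with
  | C r =>
    rw [← MvPolynomial.algebraMap_eq, AlgHom.commutes, Derivation.map_algebraMap,
      Derivation.map_algebraMap, map_zero]
  | add p q hp hq => simp only [map_add, hp, hq]
  | mul_X p i hp =>
    have hX : PowerSeries.derivative ℚ (diag (MvPolynomial.X i)) =
        diag ((derivA + derivB) (MvPolynomial.X i)) := by
      fin_cases i <;>
        simp [derivA_X, derivB_X, diag_X]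
      ring
    simp only [Derivation.leibniz, map_mul, map_add, hp, hX, smul_eq_mul]

theorem iterate_derivative_diag (f : MvPolynomial (Fin 4) ℚ) (k : ℕ) :
    (PowerSeries.derivative ℚ)^[k] (diag f) = diag ((derivA + derivB)^[k] f) := by
  induction k generalizing f with
  | zero => rfl
  | succ k ih => rw [Function.iterate_succ_apply, derivative_diag, ih, Function.iterate_succ_apply]

/-- Source of the signs and of the outer derivatives in the final formulas. -/
theorem diag_iterate_derivA (N : ℕ) (f : MvPolynomial (Fin 4) ℚ) :
    diag (derivA^[N] f) = ∑ p ∈ Finset.range (N + 1),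
      ((N.choose p : ℚ) * (-1) ^ p) •
        (PowerSeries.derivative ℚ)^[N - p] (diag (derivB^[p] f)) := by
  rw [iterate_derivation_of_commute derivA derivB derivA_derivB, map_sum]
  simp only [map_smul, iterate_derivative_diag]

theorem inv_one_sub_pow_mul_pow (i j : ℕ) :
    (((1 - PowerSeries.X) ^ i * (1 - PowerSeries.X ^ 2) ^ j)⁻¹ : ℚ⟦X⟧) =
      ((1 - PowerSeries.X)⁻¹) ^ i * ((1 - PowerSeries.X ^ 2)⁻¹) ^ j := by
  have h1 : ((1 - PowerSeries.X) * (1 - PowerSeries.X)⁻¹ : ℚ⟦X⟧) = 1 :=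
    PowerSeries.mul_inv_cancel _ (by simp)
  have h2 : ((1 - PowerSeries.X ^ 2) * (1 - PowerSeries.X ^ 2)⁻¹ : ℚ⟦X⟧) = 1 :=
    PowerSeries.mul_inv_cancel _ (by simp)
  rw [eq_comm, PowerSeries.eq_inv_iff_mul_eq_one (by simp)]
  calc _ = ((1 - PowerSeries.X) * (1 - PowerSeries.X)⁻¹ : ℚ⟦X⟧) ^ i *
        ((1 - PowerSeries.X ^ 2) * (1 - PowerSeries.X ^ 2)⁻¹) ^ j := by
        rw [mul_pow, mul_pow]; ring
    _ = 1 := by rw [h1, h2]; simp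

/-- The inner sum of the formula, as a partial derivative restricted to the diagonal. -/
theorem diag_iterate_derivB (N p : ℕ) (L : MvPolynomial (Fin 4) ℚ) (hL : derivB L = 0) :
    diag (derivB^[p] (L * MvPolynomial.X 0 ^ N *
        (MvPolynomial.X 2 ^ (N + 1) * MvPolynomial.X 3 ^ (N + 1)))) =
      ∑ i ∈ Finset.range (p + 1),
        ((p.choose i : ℚ) * (shiftedFactorial (N + 1) i : ℚ) *
            (shiftedFactorial (N + 1) (p - i) : ℚ)) •
          (diag L * PowerSeries.X ^ (N + p - i) *
            ((1 - PowerSeries.X) ^ (N + 1 + i) *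
              (1 - PowerSeries.X ^ 2) ^ (N + 1 + p - i))⁻¹ : ℚ⟦X⟧) := by
  have h0 : derivB (MvPolynomial.X 0) = 0 := by simp [derivB_X]
  have hc : derivB (L * MvPolynomial.X 0 ^ N) = 0 := by
    simp [Derivation.leibniz, Derivation.leibniz_pow, h0, hL]
  have h2 : derivB (MvPolynomial.X 2) = 1 * MvPolynomial.X 2 ^ 2 := by simp [derivB_X]
  have h3 : derivB (MvPolynomial.X 3) = MvPolynomial.X 0 * MvPolynomial.X 3 ^ 2 := by
    simp [derivB_X]
  rw [iterate_derivation_mul_of_map_eq_zero derivB hc, iterate_derivation_mul, map_mul, map_sum,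
    Finset.mul_sum]
  refine Finset.sum_congr rfl fun i hi => ?_
  have hi' : i ≤ p := Nat.lt_succ_iff.mp (Finset.mem_range.mp hi)
  rw [iterate_derivation_pow_of_riccati derivB h2 (Derivation.map_one_eq_zero _),
    iterate_derivation_pow_of_riccati derivB h3 h0, inv_one_sub_pow_mul_pow, Algebra.smul_def]
  simp only [map_mul, map_pow, map_natCast, diag_X, one_pow, one_mul]
  rw [show N + p - i = N + (p - i) by omega, show N + 1 + p - i = N + 1 + (p - i) by omega]
  simp only [Matrix.cons_val]
  ring

/-! ### Binomial product series as N-fold derivatives -/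

/-- The series `∑_k C(N+k, N) C(N+k+t, N) y^k`. -/
noncomputable def binomialProductSeries (N t : ℕ) : ℚ⟦X⟧ :=
  PowerSeries.mk fun k => ((N + k).choose N : ℚ) * ((N + k + t).choose N : ℚ)

theorem inv_one_sub_pow (N : ℕ) :
    ((1 - PowerSeries.X)⁻¹ ^ (N + 1) : ℚ⟦X⟧) =
      PowerSeries.mk fun k => ((N + k).choose N : ℚ) := by
  have h : ((1 - PowerSeries.X) * (1 - PowerSeries.X)⁻¹ : ℚ⟦X⟧) = 1 :=
    PowerSeries.mul_inv_cancel _ (by simp)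
  calc _ = ((PowerSeries.mk fun k => ((N + k).choose N : ℚ)) * (1 - PowerSeries.X) ^ (N + 1)) *
        (1 - PowerSeries.X : ℚ⟦X⟧)⁻¹ ^ (N + 1) := by
        rw [PowerSeries.mk_add_choose_mul_one_sub_pow_eq_one, one_mul]
    _ = _ := by rw [mul_assoc, ← mul_pow, h, one_pow, mul_one]

/-- The coefficient C(N+j,N) of y^{N+t+j} gets multiplied by (N+t+j)!/(t+j)! = N! C(N+j+t,N). -/
theorem iterate_derivative_X_pow_mul_inv (N t : ℕ) :
    (PowerSeries.derivative ℚ)^[N]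
        (PowerSeries.X ^ (N + t) * (1 - PowerSeries.X)⁻¹ ^ (N + 1)) =
      (N ! : ℚ) • (PowerSeries.X ^ t * binomialProductSeries N t) := by
  rw [inv_one_sub_pow]
  ext k
  rw [PowerSeries.coeff_iterate_derivative, PowerSeries.coeff_smul, PowerSeries.coeff_X_pow_mul',
    PowerSeries.coeff_X_pow_mul', smul_eq_mul]
  by_cases h : t ≤ k
  · obtain ⟨j, rfl⟩ := Nat.exists_eq_add_of_le h
    rw [if_pos (by omega), if_pos (by omega), binomialProductSeries, PowerSeries.coeff_mk,
      PowerSeries.coeff_mk, Nat.ascFactorial_eq_factorial_mul_choose,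
      show t + j + N = N + j + t by omega, show N + j + t - (N + t) = j by omega,
      show t + j - t = j by omega]
    push_cast
    ring
  · rw [if_neg (by omega), if_neg h]
    simp

theorem expand_inv_one_sub_X :
    PowerSeries.expand 2 two_ne_zero ((1 - PowerSeries.X)⁻¹ : ℚ⟦X⟧) =
      (1 - PowerSeries.X ^ 2)⁻¹ := by
  rw [PowerSeries.eq_inv_iff_mul_eq_one (by simp)]
  have h : ((1 - PowerSeries.X)⁻¹ * (1 - PowerSeries.X) : ℚ⟦X⟧) = 1 :=
    PowerSeries.inv_mul_cancel _ (by simp)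
  have := congrArg (PowerSeries.expand 2 two_ne_zero) h
  rwa [map_mul, map_sub, map_one, PowerSeries.expand_X] at this

/-- With G(y) = y^{N+t} (1-y)^{-N-1}, the function differentiated on the left is b^{-N-t} G(ab), so
b^t times its N-th a-derivative is G^{(N)}(ab). The factor z^t avoids negative powers; the two
Leibniz expansions then agree term by term. -/
theorem X_pow_mul_diag_iterate_derivA (N t : ℕ) :
    PowerSeries.X ^ t * diag (derivA^[N] (MvPolynomial.X 0 ^ (N + t) * MvPolynomial.X 3 ^ (N + 1))) =
      PowerSeries.expand 2 two_ne_zero ((PowerSeries.derivative ℚ)^[N]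
        (PowerSeries.X ^ (N + t) * (1 - PowerSeries.X)⁻¹ ^ (N + 1))) := by
  have h0 : derivA (MvPolynomial.X 0) = 1 := by simp [derivA_X]
  have h1 : derivA (MvPolynomial.X 1) = 0 := by simp [derivA_X]
  have h3 : derivA (MvPolynomial.X 3) = MvPolynomial.X 1 * MvPolynomial.X 3 ^ 2 := by
    simp [derivA_X]
  have hX : PowerSeries.derivative ℚ PowerSeries.X = 1 := PowerSeries.derivative_X
  have hu : PowerSeries.derivative ℚ (1 - PowerSeries.X)⁻¹ =
      1 * (1 - PowerSeries.X)⁻¹ ^ 2 := by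
    simp
  rw [iterate_derivation_mul, iterate_derivation_mul, map_sum, map_sum, Finset.mul_sum]
  refine Finset.sum_congr rfl fun i hi => ?_
  have hi' : i ≤ N := Nat.lt_succ_iff.mp (Finset.mem_range.mp hi)
  rw [iterate_derivation_pow derivA h0, iterate_derivation_pow_of_riccati derivA h3 h1,
    iterate_derivation_pow _ hX,
    iterate_derivation_pow_of_riccati _ hu (Derivation.map_one_eq_zero _)]
  simp only [map_mul, map_pow, map_natCast, diag_X, one_pow, one_mul, expand_inv_one_sub_X,
    PowerSeries.expand_X, ← pow_mul]
  obtain ⟨j, rfl⟩ := Nat.exists_eq_add_of_le hi'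
  rw [show i + j + t - i = j + t by omega, show i + j - i = j by omega]
  simp only [Matrix.cons_val]
  ring

theorem diag_iterate_derivA_X_pow_mul (N t : ℕ) :
    diag (derivA^[N] (MvPolynomial.X 0 ^ (N + t) * MvPolynomial.X 3 ^ (N + 1))) =
      (N ! : ℚ) • (PowerSeries.X ^ t *
        PowerSeries.expand 2 two_ne_zero (binomialProductSeries N t)) := by
  refine mul_left_cancel₀ (pow_ne_zero t (PowerSeries.X_ne_zero (R := ℚ))) ?_
  rw [X_pow_mul_diag_iterate_derivA, iterate_derivative_X_pow_mul_inv, map_smul, map_mul, map_pow,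
    PowerSeries.expand_X, mul_smul_comm]
  ring_nf

/-- The shape of the right hand sides of the theorem, with `L` in place of `1` or `1 - z`. -/
theorem sum_iterate_derivative_eq (N : ℕ) (L : MvPolynomial (Fin 4) ℚ) (hL : derivB L = 0) :
    ∑ k ∈ Finset.Icc 1 (N + 1),
        ((-1 : ℚ) ^ (N + 1 - k) / (((N + 1 - k)! : ℚ) * ((k - 1)! : ℚ))) •
          (PowerSeries.derivative ℚ)^[k - 1]
            (∑ i ∈ Finset.range (N + 1 - k + 1),
              ((Nat.choose (N + 1 - k) i : ℚ) * (shiftedFactorial (N + 1) i : ℚ) *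
                  (shiftedFactorial (N + 1) (N + 1 - k - i) : ℚ)) •
                (diag L * PowerSeries.X ^ (2 * (N + 1) - k - i - 1) *
                  ((1 - PowerSeries.X) ^ (N + 1 + i) *
                    (1 - PowerSeries.X ^ 2) ^ (2 * (N + 1) - k - i))⁻¹ : ℚ⟦X⟧)) =
      (N ! : ℚ)⁻¹ • ((1 - PowerSeries.X)⁻¹ ^ (N + 1) *
        diag (derivA^[N] (L * MvPolynomial.X 0 ^ N * MvPolynomial.X 3 ^ (N + 1)))) := by
  have hu : derivA (MvPolynomial.X 2 ^ (N + 1)) = 0 := by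
    simp [Derivation.leibniz_pow, derivA_X]
  have h : diag (derivA^[N] (L * MvPolynomial.X 0 ^ N *
      (MvPolynomial.X 2 ^ (N + 1) * MvPolynomial.X 3 ^ (N + 1)))) =
      (1 - PowerSeries.X)⁻¹ ^ (N + 1) *
        diag (derivA^[N] (L * MvPolynomial.X 0 ^ N * MvPolynomial.X 3 ^ (N + 1))) := by
    rw [mul_left_comm, iterate_derivation_mul_of_map_eq_zero derivA hu, map_mul, map_pow, diag_X]
    rfl
  rw [← h, diag_iterate_derivA, Finset.smul_sum]
  -- Here p = n - k counts the ∂_b's, leaving k - 1 = N - p derivatives d/dz.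
  refine Finset.sum_nbij' (fun k => N + 1 - k) (fun p => N + 1 - p) ?_ ?_ ?_ ?_ ?_
  · intro k hk
    rw [Finset.mem_Icc] at hk
    rw [Finset.mem_range]
    omega
  · intro p hp
    rw [Finset.mem_range] at hp
    rw [Finset.mem_Icc]
    omega
  · intro k hk
    rw [Finset.mem_Icc] at hk
    omega
  · intro p hp
    rw [Finset.mem_range] at hp
    omega
  · intro k hk
    rw [Finset.mem_Icc] at hk
    obtain ⟨p, hp⟩ : ∃ p, N + 1 = k + p := ⟨N + 1 - k, by omega⟩
    have hk1 : N - (N + 1 - k) = k - 1 := by omega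
    rw [diag_iterate_derivB N _ L hL, smul_smul, hk1]
    congr 1
    · rw [Nat.cast_choose ℚ (show N + 1 - k ≤ N by omega), hk1]
      have := Nat.factorial_ne_zero N
      field_simp
    · refine congrArg _ (Finset.sum_congr rfl fun i _ => ?_)
      rw [show 2 * (N + 1) - k - i - 1 = N + (N + 1 - k) - i by omega,
        show 2 * (N + 1) - k - i = N + 1 + (N + 1 - k) - i by omega]

/-! ### Raising and lowering operators on weight spaces -/

section WeightSpaces

variable {K M : Type*} [Field K] [AddCommGroup M] [Module K M]
  {D E : M →ₗ[K] M} {V : ℤ → Submodule K M} {B : ℤ}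

theorem iterate_raising_mem (hE : ∀ w, ∀ x ∈ V w, E x ∈ V (w + 1)) {w : ℤ} {x : M}
    (hx : x ∈ V w) (k : ℕ) : E^[k] x ∈ V (w + k) := by
  induction k with
  | zero => simpa using hx
  | succ k ih =>
    rw [Function.iterate_succ_apply']
    simpa [add_assoc] using hE _ _ ih

theorem iterate_lowering_mem (hD : ∀ w, ∀ x ∈ V w, D x ∈ V (w - 1)) {w : ℤ} {x : M}
    (hx : x ∈ V w) (k : ℕ) : D^[k] x ∈ V (w - k) := by
  induction k with
  | zero => simpa using hx
  | succ k ih =>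
    rw [Function.iterate_succ_apply']
    simpa [sub_sub] using hD _ _ ih

/-- Each commutation of D past an E contributes -2 times the current weight; the scalar is -2(w +
(w+1) + ⋯ + (w+k)). -/
theorem lowering_iterate_raising (hE : ∀ w, ∀ x ∈ V w, E x ∈ V (w + 1))
    (hc : ∀ w, ∀ x ∈ V w, D (E x) - E (D x) = (-2 * w : K) • x) {w : ℤ} {x : M}
    (hx : x ∈ V w) (hDx : D x = 0) (k : ℕ) :
    D (E^[k + 1] x) = (-(k + 1) * (2 * w + k) : K) • E^[k] x := by
  induction k with
  | zero =>
    have := hc w x hx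
    rw [hDx, map_zero, sub_zero] at this
    simp [this]
  | succ k ih =>
    have := hc _ _ (iterate_raising_mem hE hx (k + 1))
    rw [← Function.iterate_succ_apply' (⇑E), ih, map_smul, ← Function.iterate_succ_apply' (⇑E),
      sub_eq_iff_eq_add, ← add_smul] at this
    rw [this]
    congr 1
    push_cast
    ring

/-- The scalar is -2(w + (w-1) + ⋯ + (w-k)), collected while moving E past the D's. -/
theorem iterate_lowering_raising (hD : ∀ w, ∀ x ∈ V w, D x ∈ V (w - 1))
    (hc : ∀ w, ∀ x ∈ V w, D (E x) - E (D x) = (-2 * w : K) • x) {w : ℤ} {x : M}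
    (hx : x ∈ V w) (k : ℕ) :
    D^[k + 1] (E x) = E (D^[k + 1] x) + ((k + 1) * (-2 * w + k) : K) • D^[k] x := by
  induction k with
  | zero =>
    have := hc w x hx
    rw [sub_eq_iff_eq_add'] at this
    simp [this]
  | succ k ih =>
    have := hc _ _ (iterate_lowering_mem hD hx (k + 1))
    rw [sub_eq_iff_eq_add', ← Function.iterate_succ_apply' (⇑D)] at this
    rw [Function.iterate_succ_apply', ih, map_add, map_smul, this,
      ← Function.iterate_succ_apply' (⇑D), add_assoc, ← add_smul]
    congr 2
    push_cast
    ring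

variable [CharZero K]

/-- A high power of E kills x because weights are bounded. Applying D to E^{k+1} x = 0 gives E^k x =
0 as long as 2w + k ≠ 0, so the vanishing descends to exponent m. -/
theorem raising_iterate_eq_zero_of_lowering_eq_zero
    (hE : ∀ w, ∀ x ∈ V w, E x ∈ V (w + 1))
    (hc : ∀ w, ∀ x ∈ V w, D (E x) - E (D x) = (-2 * w : K) • x)
    (hB : ∀ w, B < w → V w = ⊥) {w : ℤ} {x : M} (hx : x ∈ V w) (hDx : D x = 0)
    (m : ℕ) (hm : ∀ k : ℕ, m ≤ k → 2 * w + k ≠ 0) : E^[m] x = 0 := by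
  have hlarge : E^[m + (B - w + 1).toNat] x = 0 := by
    have := iterate_raising_mem hE hx (m + (B - w + 1).toNat)
    rwa [hB _ (by push_cast; omega), Submodule.mem_bot] at this
  revert hlarge
  induction (B - w + 1).toNat with
  | zero => exact id
  | succ j ih =>
    intro h
    refine ih ?_
    have h1 := lowering_iterate_raising hE hc hx hDx (m + j)
    rw [add_assoc, h, map_zero, eq_comm, smul_eq_zero] at h1
    refine h1.resolve_left (mul_ne_zero ?_ ?_)
    · exact neg_ne_zero.mpr (Nat.cast_add_one_ne_zero _)
    · exact_mod_cast hm (m + j) (Nat.le_add_right _ _)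

/-- The lowering operator is injective on the spaces of positive weight. -/
theorem eq_zero_of_lowering_eq_zero (hE : ∀ w, ∀ x ∈ V w, E x ∈ V (w + 1))
    (hc : ∀ w, ∀ x ∈ V w, D (E x) - E (D x) = (-2 * w : K) • x)
    (hB : ∀ w, B < w → V w = ⊥) {w : ℤ} (hw : 0 < w) {x : M} (hx : x ∈ V w) (hDx : D x = 0) :
    x = 0 :=
  raising_iterate_eq_zero_of_lowering_eq_zero hE hc hB hx hDx 0 (by omega)

theorem raising_eq_zero_of_lowering_eq_zero (hE : ∀ w, ∀ x ∈ V w, E x ∈ V (w + 1))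
    (hc : ∀ w, ∀ x ∈ V w, D (E x) - E (D x) = (-2 * w : K) • x)
    (hB : ∀ w, B < w → V w = ⊥) {x : M} (hx : x ∈ V 0) (hDx : D x = 0) : E x = 0 :=
  raising_iterate_eq_zero_of_lowering_eq_zero hE hc hB hx hDx 1 (by omega)

/-- The lowering operator is surjective onto the spaces of negative weight. -/
theorem exists_lowering_eq (hD : ∀ w, ∀ x ∈ V w, D x ∈ V (w - 1))
    (hE : ∀ w, ∀ x ∈ V w, E x ∈ V (w + 1))
    (hc : ∀ w, ∀ x ∈ V w, D (E x) - E (D x) = (-2 * w : K) • x)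
    (hB : ∀ w, w < -B → V w = ⊥) {w : ℤ} (hw : w < 0) {x : M} (hx : x ∈ V w) :
    ∃ y ∈ V (w + 1), D y = x := by
  -- Induction on the nilpotency order of D at x: if D^{k+1} x = 0, then D E x - c x is killed by
  -- D^k, hence equals D y, and c x = D(E x - y). Here c ≠ 0 because w < 0.
  have key : ∀ k : ℕ, ∀ x ∈ V w, D^[k] x = 0 → ∃ y ∈ V (w + 1), D y = x := by
    intro k
    induction k with
    | zero => exact fun x _ h => ⟨0, zero_mem _, by rw [map_zero]; exact h.symm⟩
    | succ k ih =>
      intro x hx h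
      set c : K := (k + 1) * (-2 * w + k) with hcdef
      have hc0 : c ≠ 0 := by
        refine mul_ne_zero (Nat.cast_add_one_ne_zero k) ?_
        have : -2 * w + k ≠ 0 := by omega
        exact_mod_cast this
      have hDE : D (E x) ∈ V w := by simpa using hD _ _ (hE _ _ hx)
      obtain ⟨y, hy, hyx⟩ := ih (D (E x) - c • x) (sub_mem hDE (Submodule.smul_mem _ _ hx)) (by
        rw [← Module.End.pow_apply, map_sub, map_smul, Module.End.pow_apply,
          Module.End.pow_apply, ← Function.iterate_succ_apply (⇑D),
          iterate_lowering_raising hD hc hx k, h, map_zero, zero_add, sub_self])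
      refine ⟨c⁻¹ • (E x - y), Submodule.smul_mem _ _ (sub_mem (hE _ _ hx) hy), ?_⟩
      rw [map_smul, map_sub, hyx, sub_sub_cancel, inv_smul_smul₀ hc0]
  refine key (w + B + 1).toNat x hx ?_
  have := iterate_lowering_mem hD hx (w + B + 1).toNat
  rwa [hB _ (by omega), Submodule.mem_bot] at this

end WeightSpaces

/-! ### Derivations homogeneous for a grading -/

section GradedDerivations

open MvPolynomial

variable {K σ M : Type*}

theorem monomial_induction {P : (σ →₀ ℕ) → K → Prop} (zero : ∀ r, P 0 r)
    (add_single : ∀ e v r, P e r → P (e + Finsupp.single v 1) r) (e : σ →₀ ℕ) (r : K) :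
    P e r := by
  classical
  induction e using Finsupp.induction with
  | zero => exact zero r
  | single_add v k e _ _ ih =>
    have key : ∀ j, P (e + Finsupp.single v j) r := fun j => by
      induction j with
      | zero => simpa using ih
      | succ j ihj => simpa [Finsupp.single_add, add_assoc] using add_single _ v r ihj
    rw [add_comm]
    exact key k

variable [Field K] [AddCommMonoid M] {wt : σ → M}

theorem derivation_monomial_isWeightedHomogeneous
    (D : Derivation K (MvPolynomial σ K) (MvPolynomial σ K)) (c : M)
    (h : ∀ v, IsWeightedHomogeneous wt (D (X v)) (wt v + c)) (e : σ →₀ ℕ) (r : K) :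
    IsWeightedHomogeneous wt (D (monomial e r)) (Finsupp.weight wt e + c) := by
  induction e, r using monomial_induction with
  | zero r =>
    have : D (monomial 0 r) = 0 := Derivation.map_algebraMap D r
    rw [this]
    exact isWeightedHomogeneous_zero _ _ _
  | add_single e v r ih =>
    rw [monomial_add_single, pow_one, Derivation.leibniz, smul_eq_mul, smul_eq_mul, map_add,
      Finsupp.weight_single, one_smul]
    refine IsWeightedHomogeneous.add ?_ ?_
    · rw [add_assoc]
      exact (isWeightedHomogeneous_monomial wt e r rfl).mul (h v)
    · rw [add_right_comm, add_comm]
      exact (isWeightedHomogeneous_X K wt v).mul ih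

theorem derivation_isWeightedHomogeneous
    (D : Derivation K (MvPolynomial σ K) (MvPolynomial σ K)) (c : M)
    (h : ∀ v, IsWeightedHomogeneous wt (D (X v)) (wt v + c)) {f : MvPolynomial σ K} {x : M}
    (hf : IsWeightedHomogeneous wt f x) : IsWeightedHomogeneous wt (D f) (x + c) := by
  induction hf using IsWeightedHomogeneous.induction_on with
  | zero => rw [map_zero]; exact isWeightedHomogeneous_zero _ _ _
  | add p q hp hq hp' hq' => rw [map_add]; exact hp'.add hq'
  | monomial e r hr => exact hr ▸ derivation_monomial_isWeightedHomogeneous D c h e r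

theorem derivation_weightedHomogeneousComponent {M : Type*} [AddCancelCommMonoid M] {wt : σ → M}
    (D : Derivation K (MvPolynomial σ K) (MvPolynomial σ K)) (c : M)
    (h : ∀ v, IsWeightedHomogeneous wt (D (X v)) (wt v + c)) (f : MvPolynomial σ K) (x : M) :
    D (weightedHomogeneousComponent wt x f) = weightedHomogeneousComponent wt (x + c) (D f) := by
  induction f using MvPolynomial.induction_on' with
  | monomial e r =>
    have h1 := isWeightedHomogeneous_monomial wt e r rfl
    have h2 := derivation_monomial_isWeightedHomogeneous D c h e r
    by_cases hx : x = Finsupp.weight wt e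
    · subst hx
      rw [h1.weightedHomogeneousComponent_same, h2.weightedHomogeneousComponent_same]
    · rw [h1.weightedHomogeneousComponent_ne _ hx,
        h2.weightedHomogeneousComponent_ne _ (fun h => hx (add_right_cancel h)), map_zero]
  | add p q hp hq => simp only [map_add, hp, hq]

theorem derivation_monomial_eq_smul
    (D : Derivation K (MvPolynomial σ K) (MvPolynomial σ K)) (χ : M →+ K)
    (h : ∀ v, D (X v) = χ (wt v) • X v) (e : σ →₀ ℕ) (r : K) :
    D (monomial e r) = χ (Finsupp.weight wt e) • monomial e r := by
  induction e, r using monomial_induction with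
  | zero r =>
    have : D (monomial 0 r) = 0 := Derivation.map_algebraMap D r
    rw [this, map_zero, map_zero, zero_smul]
  | add_single e v r ih =>
    rw [monomial_add_single, pow_one, Derivation.leibniz, smul_eq_mul, smul_eq_mul, map_add,
      Finsupp.weight_single, one_smul, ih, h, map_add, add_smul, mul_smul_comm, mul_smul_comm,
      mul_comm (X v), add_comm]

theorem derivation_eq_smul
    (D : Derivation K (MvPolynomial σ K) (MvPolynomial σ K)) (χ : M →+ K)
    (h : ∀ v, D (X v) = χ (wt v) • X v) {f : MvPolynomial σ K} {x : M}
    (hf : IsWeightedHomogeneous wt f x) : D f = χ x • f := by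
  induction hf using IsWeightedHomogeneous.induction_on with
  | zero => rw [map_zero, smul_zero]
  | add p q hp hq hp' hq' => rw [map_add, hp', hq', smul_add]
  | monomial e r hr => rw [← hr, derivation_monomial_eq_smul D χ h]

end GradedDerivations

/-! ### The weight grading for n quadratic forms -/

section Quadratics

open MvPolynomial

variable {K : Type*} [Field K] {n : ℕ}

/-- The degree and the weight of the variables attached to `n` quadratic forms. -/
def bidegree (v : Var (fun _ : Fin n => 2)) : ℕ × ℤ := (1, (v.2 : ℕ) - 1)

theorem derivD_X_isWeightedHomogeneous (v : Var (fun _ : Fin n => 2)) :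
    IsWeightedHomogeneous bidegree (derivD K (fun _ : Fin n => 2) (X v))
      (bidegree v + (0, -1)) := by
  rw [derivD, mkDerivation_X]
  split_ifs with h
  · rw [smul_eq_C_mul]
    refine IsWeightedHomogeneous.C_mul ?_ _
    convert isWeightedHomogeneous_X K bidegree _ using 1
    refine Prod.ext rfl ?_
    simp only [bidegree, Prod.snd_add]
    omega
  · exact isWeightedHomogeneous_zero _ _ _

theorem derivDstar_X_isWeightedHomogeneous (v : Var (fun _ : Fin n => 2)) :
    IsWeightedHomogeneous bidegree (derivDstar K (fun _ : Fin n => 2) (X v))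
      (bidegree v + (0, 1)) := by
  rw [derivDstar, mkDerivation_X]
  split_ifs with h
  · rw [smul_eq_C_mul]
    refine IsWeightedHomogeneous.C_mul ?_ _
    convert isWeightedHomogeneous_X K bidegree _ using 1
    refine Prod.ext rfl ?_
    simp only [bidegree, Prod.snd_add]
    omega
  · exact isWeightedHomogeneous_zero _ _ _

/-- The commutator is again a derivation, so its eigenvalues on the variables determine it on every
bihomogeneous form. -/
theorem commutator_X (v : Var (fun _ : Fin n => 2)) :
    ⁅derivD K (fun _ : Fin n => 2), derivDstar K (fun _ : Fin n => 2)⁆ (X v) =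
      ((AddMonoidHom.mulLeft (-2 : K)).comp
        ((Int.castAddHom K).comp (AddMonoidHom.snd ℕ ℤ))) (bidegree v) • X v := by
  obtain ⟨k, i, hi⟩ := v
  simp only [Derivation.commutator_apply, derivD, derivDstar, mkDerivation_X, bidegree]
  change i < 3 at hi
  interval_cases i
  · simp
  · simp
    module
  · simp
    module

/-- The space of forms of degree `m` and weight `w`. -/
noncomputable def weightSpace (K : Type*) [Field K] (n m : ℕ) (w : ℤ) :
    Submodule K (MvPolynomial (Var (fun _ : Fin n => 2)) K) :=
  weightedHomogeneousSubmodule K bidegree (m, w)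

theorem derivD_mem_weightSpace (m : ℕ) (w : ℤ) :
    ∀ f ∈ weightSpace K n m w,
      (derivD K (fun _ : Fin n => 2)).toLinearMap f ∈ weightSpace K n m (w - 1) := fun _ hf =>
  derivation_isWeightedHomogeneous _ (0, -1) derivD_X_isWeightedHomogeneous hf

theorem derivDstar_mem_weightSpace (m : ℕ) (w : ℤ) :
    ∀ f ∈ weightSpace K n m w,
      (derivDstar K (fun _ : Fin n => 2)).toLinearMap f ∈ weightSpace K n m (w + 1) := fun _ hf =>
  derivation_isWeightedHomogeneous _ (0, 1) derivDstar_X_isWeightedHomogeneous hf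

theorem commutator_of_mem_weightSpace (m : ℕ) (w : ℤ) :
    ∀ f ∈ weightSpace K n m w,
      (derivD K (fun _ : Fin n => 2)).toLinearMap
          ((derivDstar K (fun _ : Fin n => 2)).toLinearMap f) -
        (derivDstar K (fun _ : Fin n => 2)).toLinearMap
          ((derivD K (fun _ : Fin n => 2)).toLinearMap f) = (-2 * w : K) • f := fun _ hf =>
  derivation_eq_smul _ _ commutator_X hf

theorem weight_bidegree_fst (e : Var (fun _ : Fin n => 2) →₀ ℕ) :
    (Finsupp.weight bidegree e).1 = e.degree := by
  simp [Finsupp.weight_apply, Finsupp.sum, Finsupp.degree_apply, Prod.fst_sum, bidegree]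

theorem weight_bidegree_snd (e : Var (fun _ : Fin n => 2) →₀ ℕ) :
    (Finsupp.weight bidegree e).2 = ∑ v ∈ e.support, (e v : ℤ) * ((v.2 : ℕ) - 1) := by
  simp [Finsupp.weight_apply, Finsupp.sum, Prod.snd_sum, bidegree]

theorem abs_weight_bidegree_snd_le (e : Var (fun _ : Fin n => 2) →₀ ℕ) :
    |(Finsupp.weight bidegree e).2| ≤ e.degree := by
  rw [weight_bidegree_snd, Finsupp.degree_apply, Nat.cast_sum]
  refine (Finset.abs_sum_le_sum_abs _ _).trans (Finset.sum_le_sum fun v _ => ?_)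
  rw [abs_mul, Nat.abs_cast]
  have : |((v.2 : ℕ) - 1 : ℤ)| ≤ 1 := by
    have : (v.2 : ℕ) < 3 := v.2.isLt
    rw [abs_le]
    omega
  nlinarith

theorem weightSpace_eq_bot (m : ℕ) {w : ℤ} (hw : (m : ℤ) < |w|) : weightSpace K n m w = ⊥ := by
  rw [eq_bot_iff]
  intro f hf
  rw [Submodule.mem_bot]
  ext e
  by_contra h
  have h1 := hf h
  have h2 := abs_weight_bidegree_snd_le e
  rw [← weight_bidegree_fst, h1] at h2
  exact absurd h2 (not_le.mpr hw)

end Quadratics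

/-! ### Dimensions of graded parts as numbers of monomials -/

open MvPolynomial

theorem finrank_ker_inf_add {K M : Type*} [Field K] [AddCommGroup M] [Module K M]
    (D : M →ₗ[K] M) (p q : Submodule K M) [Module.Finite K p] (hpq : ∀ x ∈ p, D x ∈ q)
    (hqp : ∀ y ∈ q, ∃ x ∈ p, D x = y) :
    Module.finrank K ↥(LinearMap.ker D ⊓ p) + Module.finrank K q = Module.finrank K p := by
  have hq : q = LinearMap.range (D.domRestrict p) := by
    ext y
    rw [LinearMap.mem_range]
    constructor
    · intro hy
      obtain ⟨x, hx, hxy⟩ := hqp y hy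
      exact ⟨⟨x, hx⟩, hxy⟩
    · rintro ⟨x, rfl⟩
      exact hpq x x.2
  have hk : Module.finrank K ↥(LinearMap.ker D ⊓ p) =
      Module.finrank K (LinearMap.ker (D.domRestrict p)) := by
    have h1 : LinearMap.ker D ⊓ p =
        (LinearMap.ker (D.domRestrict p)).map p.subtype := by
      ext x
      simp [and_comm]
    rw [h1]
    exact Submodule.finrank_map_subtype_eq _ _
  rw [hk, hq, add_comm, LinearMap.finrank_range_add_finrank_ker]

theorem finrank_restrictSupport (K : Type*) {σ : Type*} [Field K] (s : Set (σ →₀ ℕ)) :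
    Module.finrank K (restrictSupport K s) = s.ncard :=
  (Module.finrank_eq_nat_card_basis (basisRestrictSupport K s)).trans (Nat.card_coe_set_eq s)

section Quadratics

variable {K : Type*} [Field K] {n : ℕ}

/-- The exponents of degree `m` and weight `w`. -/
def bidegreeFiber (n m : ℕ) (w : ℤ) : Set (Var (fun _ : Fin n => 2) →₀ ℕ) :=
  {e | Finsupp.weight bidegree e = (m, w)}

/-- The exponents of degree `m` and weight at most `w`. -/
def bidegreeLowerSet (n m : ℕ) (w : ℤ) : Set (Var (fun _ : Fin n => 2) →₀ ℕ) :=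
  {e | (Finsupp.weight bidegree e).1 = m ∧ (Finsupp.weight bidegree e).2 ≤ w}

theorem bidegreeLowerSet_finite (m : ℕ) (w : ℤ) : (bidegreeLowerSet n m w).Finite :=
  (Finsupp.finite_of_degree_le m).subset fun e he =>
    (weight_bidegree_fst e ▸ he.1 : e.degree = m).le

theorem bidegreeFiber_subset (m : ℕ) {w c : ℤ} (h : w ≤ c) :
    bidegreeFiber n m w ⊆ bidegreeLowerSet n m c := fun e he => by
  have he' : Finsupp.weight bidegree e = (m, w) := he
  exact ⟨by rw [he'], by rw [he']; exact h⟩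

theorem weightSpace_eq_restrictSupport (m : ℕ) (w : ℤ) :
    weightSpace K n m w = restrictSupport K (bidegreeFiber n m w) :=
  weightedHomogeneousSubmodule_eq_finsupp_supported _ _ _

theorem finrank_weightSpace (m : ℕ) (w : ℤ) :
    Module.finrank K (weightSpace K n m w) = (bidegreeFiber n m w).ncard := by
  rw [weightSpace_eq_restrictSupport, finrank_restrictSupport]

instance (m : ℕ) (w : ℤ) : Module.Finite K (restrictSupport K (bidegreeLowerSet n m w)) :=
  have := (bidegreeLowerSet_finite (n := n) m w).to_subtype
  Module.Finite.of_basis (basisRestrictSupport K (bidegreeLowerSet n m w))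

instance (m : ℕ) (w : ℤ) : Module.Finite K (weightSpace K n m w) := by
  rw [weightSpace_eq_restrictSupport]
  have := ((bidegreeLowerSet_finite m w).subset (bidegreeFiber_subset (n := n) m le_rfl)).to_subtype
  exact Module.Finite.of_basis (basisRestrictSupport K (bidegreeFiber n m w))

theorem ncard_bidegreeLowerSet (m : ℕ) :
    (bidegreeLowerSet n m 0).ncard =
      (bidegreeFiber n m 0).ncard + (bidegreeLowerSet n m (-1)).ncard := by
  rw [← Set.ncard_union_eq ?_
    ((bidegreeLowerSet_finite m 0).subset (bidegreeFiber_subset m le_rfl))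
    (bidegreeLowerSet_finite m (-1))]
  · congr 1
    ext e
    simp only [bidegreeLowerSet, bidegreeFiber, Set.mem_union, Set.mem_ofPred_eq, Prod.ext_iff]
    omega
  · rw [Set.disjoint_left]
    intro e he he'
    have h1 : Finsupp.weight bidegree e = (m, 0) := he
    have h2 := he'.2
    rw [h1] at h2
    exact absurd h2 (by norm_num)

theorem weightedHomogeneousComponent_mem_weightSpace (m : ℕ) (w : ℤ)
    (f : MvPolynomial (Var (fun _ : Fin n => 2)) K) :
    weightedHomogeneousComponent bidegree (m, w) f ∈ weightSpace K n m w :=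
  weightedHomogeneousComponent_mem _ _ _

variable [CharZero K]

theorem exists_derivD_eq (m : ℕ) {w : ℤ} (hw : w < 0) :
    ∀ f ∈ weightSpace K n m w, ∃ g ∈ weightSpace K n m (w + 1),
      (derivD K (fun _ : Fin n => 2)).toLinearMap g = f := fun _ hf =>
  exists_lowering_eq (B := m) (derivD_mem_weightSpace m) (derivDstar_mem_weightSpace m)
    (commutator_of_mem_weightSpace m)
    (fun w hw => weightSpace_eq_bot m (by rw [lt_abs]; omega)) hw hf

theorem weightedHomogeneousComponent_eq_zero_of_derivD_eq_zero {f : MvPolynomial (Var (fun _ : Fin n => 2)) K}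
    (hf : derivD K (fun _ : Fin n => 2) f = 0) (m : ℕ) {w : ℤ} (hw : 0 < w) :
    weightedHomogeneousComponent bidegree (m, w) f = 0 :=
  eq_zero_of_lowering_eq_zero (B := m) (D := (derivD K (fun _ : Fin n => 2)).toLinearMap)
    (derivDstar_mem_weightSpace m)
    (commutator_of_mem_weightSpace m)
    (fun w hw => weightSpace_eq_bot m (by rw [lt_abs]; omega)) hw
    (weightedHomogeneousComponent_mem_weightSpace m w f) (by
      rw [Derivation.coeFn_coe, derivation_weightedHomogeneousComponent _ _
        derivD_X_isWeightedHomogeneous, hf, map_zero])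

/-- Injectivity of D on positive weights confines its kernel to weights ≤ 0. Since D maps weights ≤
0 onto weights ≤ -1, rank-nullity leaves exactly the weight-0 count. -/
theorem finrank_gradedPart_semiInvariants (m : ℕ) :
    Module.finrank K (gradedPart (semiInvariants K (fun _ : Fin n => 2)) m) =
      (bidegreeFiber n m 0).ncard := by
  classical
  have h : gradedPart (semiInvariants K (fun _ : Fin n => 2)) m =
      LinearMap.ker (derivD K (fun _ : Fin n => 2)).toLinearMap ⊓
        restrictSupport K (bidegreeLowerSet n m 0) := by
    ext f
    constructor
    · rintro ⟨h1, h2⟩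
      refine ⟨h1, fun e he => ?_⟩
      have he' : coeff e f ≠ 0 := mem_support_iff.mp he
      have hm : (Finsupp.weight bidegree e).1 = m := by
        rw [weight_bidegree_fst, Finsupp.degree_eq_weight_one]
        exact h2 he'
      have hme : Finsupp.weight bidegree e = (m, (Finsupp.weight bidegree e).2) :=
        Prod.ext hm rfl
      refine ⟨hm, not_lt.mp fun hpos => he' ?_⟩
      have := congrArg (coeff e) (weightedHomogeneousComponent_eq_zero_of_derivD_eq_zero h1 m hpos)
      rwa [coeff_weightedHomogeneousComponent, if_pos hme, coeff_zero] at this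
    · rintro ⟨h1, h2⟩
      refine ⟨h1, fun e he => ?_⟩
      have := (h2 (mem_support_iff.mpr he)).1
      rwa [weight_bidegree_fst, Finsupp.degree_eq_weight_one] at this
  have hD : ∀ f ∈ restrictSupport K (bidegreeLowerSet n m 0),
      (derivD K (fun _ : Fin n => 2)).toLinearMap f ∈
        restrictSupport K (bidegreeLowerSet n m (-1)) := by
    intro f hf
    have : restrictSupport K (bidegreeLowerSet n m 0) ≤
        (restrictSupport K (bidegreeLowerSet n m (-1))).comap
          (derivD K (fun _ : Fin n => 2)).toLinearMap := by
      rw [restrictSupport_eq_span, Submodule.span_le]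
      rintro _ ⟨e, ⟨he1, he2⟩, rfl⟩
      have h1 : monomial e 1 ∈ weightSpace K n m (Finsupp.weight bidegree e).2 :=
        isWeightedHomogeneous_monomial _ _ _ (Prod.ext he1 rfl)
      have h2 := derivD_mem_weightSpace m _ _ h1
      rw [weightSpace_eq_restrictSupport] at h2
      exact restrictSupport_mono _ (bidegreeFiber_subset m (by omega)) h2
    exact this hf
  have hsurj : ∀ g ∈ restrictSupport K (bidegreeLowerSet n m (-1)),
      ∃ f ∈ restrictSupport K (bidegreeLowerSet n m 0),
        (derivD K (fun _ : Fin n => 2)).toLinearMap f = g := by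
    intro g hg
    have : restrictSupport K (bidegreeLowerSet n m (-1)) ≤
        (restrictSupport K (bidegreeLowerSet n m 0)).map
          (derivD K (fun _ : Fin n => 2)).toLinearMap := by
      rw [restrictSupport_eq_span, Submodule.span_le]
      rintro _ ⟨e, ⟨he1, he2⟩, rfl⟩
      have h1 : monomial e 1 ∈ weightSpace K n m (Finsupp.weight bidegree e).2 :=
        isWeightedHomogeneous_monomial _ _ _ (Prod.ext he1 rfl)
      obtain ⟨f, hf, hfe⟩ := exists_derivD_eq m (by omega) _ h1
      rw [weightSpace_eq_restrictSupport] at hf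
      exact ⟨f, restrictSupport_mono _ (bidegreeFiber_subset m (by omega)) hf, hfe⟩
    exact this hg
  have := finrank_ker_inf_add _ _ _ hD hsurj
  rw [finrank_restrictSupport, finrank_restrictSupport, ncard_bidegreeLowerSet] at this
  rw [h]
  exact Nat.add_right_cancel this

/-- Invariants are the kernel of D on weight 0, where D is onto weight -1. -/
theorem finrank_gradedPart_invariants (m : ℕ) :
    Module.finrank K (gradedPart (invariants K (fun _ : Fin n => 2)) m) +
      (bidegreeFiber n m (-1)).ncard = (bidegreeFiber n m 0).ncard := by
  classical
  have h : gradedPart (invariants K (fun _ : Fin n => 2)) m =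
      LinearMap.ker (derivD K (fun _ : Fin n => 2)).toLinearMap ⊓ weightSpace K n m 0 := by
    ext f
    constructor
    · rintro ⟨⟨h1, h1'⟩, h2⟩
      refine ⟨h1, fun e he => ?_⟩
      have hm : (Finsupp.weight bidegree e).1 = m := by
        rw [weight_bidegree_fst, Finsupp.degree_eq_weight_one]
        exact h2 he
      have hme : Finsupp.weight bidegree e = (m, (Finsupp.weight bidegree e).2) :=
        Prod.ext hm rfl
      refine Prod.ext hm ?_
      by_contra hw
      -- Both operators kill each weight component f_w of f, so -2w f_w = 0 and only w = 0 survives.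
      have hc := commutator_of_mem_weightSpace m _ _
        (weightedHomogeneousComponent_mem_weightSpace m (Finsupp.weight bidegree e).2 f)
      simp only [Derivation.coeFn_coe, derivation_weightedHomogeneousComponent _ _
        derivD_X_isWeightedHomogeneous, derivation_weightedHomogeneousComponent _ _
        derivDstar_X_isWeightedHomogeneous, h1, h1', map_zero, sub_zero] at hc
      rw [eq_comm, smul_eq_zero] at hc
      have hf0 := hc.resolve_left
        (mul_ne_zero (neg_ne_zero.mpr two_ne_zero) (Int.cast_ne_zero.mpr hw))
      have := congrArg (coeff e) hf0
      rw [coeff_weightedHomogeneousComponent, if_pos hme, coeff_zero] at this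
      exact he this
    · rintro ⟨h1, h2⟩
      refine ⟨⟨h1, ?_⟩, fun e he => ?_⟩
      · exact raising_eq_zero_of_lowering_eq_zero (B := m)
          (D := (derivD K (fun _ : Fin n => 2)).toLinearMap)
          (derivDstar_mem_weightSpace m) (commutator_of_mem_weightSpace m)
          (fun w hw => weightSpace_eq_bot m (by rw [lt_abs]; omega)) h2 h1
      · refine (DFunLike.congr_fun Finsupp.degree_eq_weight_one e).symm.trans ?_
        rw [← weight_bidegree_fst, h2 he]
  rw [h, ← finrank_weightSpace (K := K), ← finrank_weightSpace (K := K)]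
  exact finrank_ker_inf_add _ _ _ (derivD_mem_weightSpace m 0)
    (exists_derivD_eq m (w := -1) (by norm_num))

end Quadratics

/-! ### Counting monomials of given degree and weight -/

/-- A monomial in the coefficients of `n` quadratic forms is a product of three monomials, in the
`x_0^(k)`, the `x_1^(k)` and the `x_2^(k)` respectively. -/
noncomputable def exponentEquiv (n : ℕ) :
    (Var (fun _ : Fin n => 2) →₀ ℕ) ≃ (Fin n →₀ ℕ) × (Fin n →₀ ℕ) × (Fin n →₀ ℕ) where
  toFun e := (Finsupp.equivFunOnFinite.symm fun k => e ⟨k, (0 : Fin 3)⟩,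
    Finsupp.equivFunOnFinite.symm fun k => e ⟨k, (1 : Fin 3)⟩,
    Finsupp.equivFunOnFinite.symm fun k => e ⟨k, (2 : Fin 3)⟩)
  invFun x := Finsupp.equivFunOnFinite.symm fun v =>
    (![x.1 v.1, x.2.1 v.1, x.2.2 v.1] : Fin 3 → ℕ) v.2
  left_inv e := by
    ext ⟨k, i⟩
    change Fin 3 at i
    fin_cases i <;> rfl
  right_inv x := Prod.ext (Finsupp.ext fun _ => rfl)
    (Prod.ext (Finsupp.ext fun _ => rfl) (Finsupp.ext fun _ => rfl))

theorem mem_bidegreeFiber_iff {n m t : ℕ} (e : Var (fun _ : Fin n => 2) →₀ ℕ) :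
    e ∈ bidegreeFiber n m (-t) ↔
      (∑ k, (exponentEquiv n e).1 k) + (∑ k, (exponentEquiv n e).2.1 k) +
          (∑ k, (exponentEquiv n e).2.2 k) = m ∧
        ∑ k, (exponentEquiv n e).1 k = (∑ k, (exponentEquiv n e).2.2 k) + t := by
  have h1 : (Finsupp.weight bidegree e).1 = (∑ k, (exponentEquiv n e).1 k) +
      (∑ k, (exponentEquiv n e).2.1 k) + (∑ k, (exponentEquiv n e).2.2 k) := by
    rw [weight_bidegree_fst, Finsupp.degree_eq_sum, Fintype.sum_sigma, ← Finset.sum_add_distrib,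
      ← Finset.sum_add_distrib]
    exact Finset.sum_congr rfl fun k _ => Fin.sum_univ_three _
  have h2 : (Finsupp.weight bidegree e).2 = ((∑ k, (exponentEquiv n e).2.2 k : ℕ) : ℤ) -
      ((∑ k, (exponentEquiv n e).1 k : ℕ) : ℤ) := by
    rw [weight_bidegree_snd, Finset.sum_subset (Finset.subset_univ _)
      (fun v _ hv => by rw [Finsupp.notMem_support_iff.mp hv]; simp), Fintype.sum_sigma]
    push_cast
    rw [← Finset.sum_sub_distrib]
    refine Finset.sum_congr rfl fun k _ => (Fin.sum_univ_three _).trans ?_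
    simp [exponentEquiv]
    ring
  change Finsupp.weight bidegree e = (m, (-t : ℤ)) ↔ _
  rw [Prod.ext_iff, h1, h2]
  omega

theorem card_finsuppAntidiag_univ (N c : ℕ) :
    ((Finset.univ : Finset (Fin (N + 1))).finsuppAntidiag c).card = (N + c).choose N := by
  rw [Finset.card_finsuppAntidiag_nat_eq_choose, Finset.card_univ, Fintype.card_fin,
    show N + 1 + c - 1 = N + c by omega, Nat.choose_symm_add]

/-- If j is the degree in the x_2^(k), weight -t forces degree j + t in the x_0^(k) and m - t - 2j
in the x_1^(k). The filter keeps these subtractions genuine. -/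
theorem ncard_bidegreeFiber (N m t : ℕ) :
    (bidegreeFiber (N + 1) m (-t)).ncard =
      ∑ j ∈ (Finset.range (m + 1)).filter (fun j => 2 * j + t ≤ m),
        (N + (m - t - 2 * j)).choose N * ((N + j).choose N * (N + j + t).choose N) := by
  classical
  let T : ℕ → Finset (Fin (N + 1) →₀ ℕ) := fun c => Finset.univ.finsuppAntidiag c
  have hT : ∀ c f, f ∈ T c ↔ ∑ k, f k = c := fun c f => by
    simp [T, Finset.mem_finsuppAntidiag]
  have h : (exponentEquiv (N + 1)) '' bidegreeFiber (N + 1) m (-t) =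
      (((Finset.range (m + 1)).filter (fun j => 2 * j + t ≤ m)).biUnion fun j =>
        T (j + t) ×ˢ (T (m - t - 2 * j) ×ˢ T j) : Finset _) := by
    ext ⟨f, g, h⟩
    rw [Equiv.image_eq_preimage_symm, Set.mem_preimage, mem_bidegreeFiber_iff,
      Equiv.apply_symm_apply]
    simp only [Finset.coe_biUnion, Set.mem_iUnion, Finset.mem_coe, Finset.mem_product, hT,
      Finset.mem_filter, Finset.mem_range]
    constructor
    · rintro ⟨h1, h2⟩
      exact ⟨∑ k, h k, by omega, h2, by omega, rfl⟩
    · rintro ⟨j, hj, h1, h2, h3⟩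
      omega
  rw [← Set.ncard_image_of_injective _ (exponentEquiv (N + 1)).injective, h, Set.ncard_coe_finset,
    Finset.card_biUnion]
  · refine Finset.sum_congr rfl fun j _ => ?_
    simp only [Finset.card_product, T, card_finsuppAntidiag_univ, ← add_assoc]
    ring
  · intro i _ j _ hij
    rw [Function.onFun, Finset.disjoint_left]
    rintro ⟨f, g, h⟩ hi hj
    simp only [Finset.mem_product, hT] at hi hj
    exact hij (hi.2.2.symm.trans hj.2.2)

theorem mk_ncard_bidegreeFiber (N t : ℕ) :
    (PowerSeries.mk fun m => ((bidegreeFiber (N + 1) m (-t)).ncard : ℚ)) =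
      (1 - PowerSeries.X)⁻¹ ^ (N + 1) * (PowerSeries.X ^ t *
        PowerSeries.expand 2 two_ne_zero (binomialProductSeries N t)) := by
  ext m
  rw [mul_left_comm, PowerSeries.coeff_X_pow_mul', PowerSeries.coeff_mk, ncard_bidegreeFiber,
    inv_one_sub_pow]
  split_ifs with h
  · simp only [PowerSeries.coeff_mul, PowerSeries.coeff_mk, PowerSeries.coeff_expand, mul_ite,
      mul_zero]
    rw [← Finset.sum_filter]
    push_cast
    refine Finset.sum_nbij' (fun j => (m - t - 2 * j, 2 * j)) (fun p => p.2 / 2) ?_ ?_ ?_ ?_ ?_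
    · intro j hj
      simp only [Finset.mem_filter, Finset.mem_range] at hj
      simp only [Finset.mem_filter, Finset.HasAntidiagonal.mem_antidiagonal]
      omega
    · rintro ⟨a, b⟩ hp
      simp only [Finset.mem_filter, Finset.HasAntidiagonal.mem_antidiagonal] at hp
      simp only [Finset.mem_filter, Finset.mem_range]
      omega
    · intro j _
      simp
    · rintro ⟨a, b⟩ hp
      simp only [Finset.mem_filter, Finset.HasAntidiagonal.mem_antidiagonal] at hp
      simp only [Prod.mk.injEq]
      omega
    · intro j _
      simp [binomialProductSeries]
  · rw [Finset.sum_eq_zero, Nat.cast_zero]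
    intro j hj
    rw [Finset.mem_filter] at hj
    omega

/-! ### The two Poincaré series and the conclusion -/

theorem PS_eq (K : Type*) [Field K] [CharZero K] (N : ℕ) :
    PS K (fun _ : Fin (N + 1) => 2) = (1 - PowerSeries.X)⁻¹ ^ (N + 1) *
      PowerSeries.expand 2 two_ne_zero (binomialProductSeries N 0) := by
  have h := mk_ncard_bidegreeFiber N 0
  rw [pow_zero, one_mul, Nat.cast_zero, neg_zero] at h
  rw [← h, PS, poincareSeries]
  simp only [finrank_gradedPart_semiInvariants]

theorem PI_eq (K : Type*) [Field K] [CharZero K] (N : ℕ) :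
    PI K (fun _ : Fin (N + 1) => 2) = (1 - PowerSeries.X)⁻¹ ^ (N + 1) *
      (PowerSeries.expand 2 two_ne_zero (binomialProductSeries N 0) -
        PowerSeries.X * PowerSeries.expand 2 two_ne_zero (binomialProductSeries N 1)) := by
  have h0 := mk_ncard_bidegreeFiber N 0
  have h1 := mk_ncard_bidegreeFiber N 1
  rw [pow_zero, one_mul, Nat.cast_zero, neg_zero] at h0
  rw [pow_one, Nat.cast_one] at h1
  rw [mul_sub, ← h0, ← h1, PI, poincareSeries]
  ext m
  rw [map_sub, PowerSeries.coeff_mk, PowerSeries.coeff_mk, PowerSeries.coeff_mk, eq_sub_iff_add_eq]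
  exact_mod_cast finrank_gradedPart_invariants m

end BinaryForms

theorem theorem4p2 (K : Type*) [Field K] [CharZero K] (n : ℕ) (hn : 1 ≤ n) :
    BinaryForms.PI K (fun _ : Fin n => 2) =
      ∑ k ∈ Finset.Icc 1 n,
        ((-1 : ℚ) ^ (n - k) / (((n - k)! : ℚ) * ((k - 1)! : ℚ))) •
          (PowerSeries.derivative ℚ)^[k - 1]
            (∑ i ∈ Finset.range (n - k + 1),
              ((Nat.choose (n - k) i : ℚ) * (BinaryForms.shiftedFactorial n i : ℚ) *
                  (BinaryForms.shiftedFactorial n (n - k - i) : ℚ)) •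
                ((1 - PowerSeries.X) * PowerSeries.X ^ (2 * n - k - i - 1) *
                  ((1 - PowerSeries.X) ^ (n + i) *
                    (1 - PowerSeries.X ^ 2) ^ (2 * n - k - i))⁻¹ : ℚ⟦X⟧)) ∧
    BinaryForms.PS K (fun _ : Fin n => 2) =
      ∑ k ∈ Finset.Icc 1 n,
        ((-1 : ℚ) ^ (n - k) / (((n - k)! : ℚ) * ((k - 1)! : ℚ))) •
          (PowerSeries.derivative ℚ)^[k - 1]
            (∑ i ∈ Finset.range (n - k + 1),
              ((Nat.choose (n - k) i : ℚ) * (BinaryForms.shiftedFactorial n i : ℚ) *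
                  (BinaryForms.shiftedFactorial n (n - k - i) : ℚ)) •
                (PowerSeries.X ^ (2 * n - k - i - 1) *
                  ((1 - PowerSeries.X) ^ (n + i) *
                    (1 - PowerSeries.X ^ 2) ^ (2 * n - k - i))⁻¹ : ℚ⟦X⟧)) := by
  obtain ⟨N, rfl⟩ : ∃ N, n = N + 1 := ⟨n - 1, by omega⟩
  have hfac : (N ! : ℚ) ≠ 0 := Nat.cast_ne_zero.mpr N.factorial_ne_zero
  -- The factor 1 - z is lifted to 1 - a, not 1 - b, so that ∂_b treats it as constant.
  have hX : BinaryForms.derivB (1 - MvPolynomial.X 0) = 0 := by simp [BinaryForms.derivB_X]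
  have hone : BinaryForms.diag 1 = 1 := map_one _
  have hsub : BinaryForms.diag (1 - MvPolynomial.X 0) = 1 - PowerSeries.X := by
    rw [map_sub, map_one, BinaryForms.diag_X]
    rfl
  have hformI := BinaryForms.sum_iterate_derivative_eq N (1 - MvPolynomial.X 0) hX
  have hformS := BinaryForms.sum_iterate_derivative_eq N 1 (Derivation.map_one_eq_zero _)
  have h0 := BinaryForms.diag_iterate_derivA_X_pow_mul N 0
  have h1 := BinaryForms.diag_iterate_derivA_X_pow_mul N 1
  simp only [hsub] at hformI
  simp only [hone, one_mul] at hformS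
  rw [add_zero, pow_zero, one_mul] at h0
  rw [pow_one] at h1
  -- Multiplying by 1 - a produces the difference of the cases t = 0 and t = 1, matching weight 0
  -- minus weight -1.
  have hsplit : ((1 - MvPolynomial.X 0) * MvPolynomial.X 0 ^ N * MvPolynomial.X 3 ^ (N + 1) :
      MvPolynomial (Fin 4) ℚ) = MvPolynomial.X 0 ^ N * MvPolynomial.X 3 ^ (N + 1) -
        MvPolynomial.X 0 ^ (N + 1) * MvPolynomial.X 3 ^ (N + 1) := by
    ring
  constructor
  · rw [BinaryForms.PI_eq, hformI, hsplit, iterate_map_sub, map_sub, h0, h1, ← smul_sub,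
      mul_smul_comm, inv_smul_smul₀ hfac]
  · rw [BinaryForms.PS_eq, hformS, h0, mul_smul_comm, inv_smul_smul₀ hfac]
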